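/- Let $\mathcal A$ be a finitely cocomplete homological category, i.e. a pointed, regular (in particular finitely complete) and protomodular category with finite colimits. For objects $X,Y,Z$ of $\mathcal A$ let $$\iota_{X,Y}\colon X\otimes Y\to X+Y,\qquad \iota_{X,Y,Z}\colon X\otimes Y\otimes Z\to X+Y+Z$$ denote the kernels of the canonical comparison morphisms $X+Y\to X\times Y$ and $X+Y+Z\to (X+Y)\times(X+Z)\times(Y+Z)$ (each component of which is the retraction that sends the omitted summand to $0$). For subobjects $k\colon K\to X$, $l\colon L\to X$, $m\colon M\to X$ of an object $X$, the Higgins commutator $[K,L]\leq X$ is the image of $K\otimes L\to K+L\to X$ and the ternary commutator $[K,L,M]\leq X$ is the image of $K\otimes L\otimes M\to K+L+M\to X$, where the second morphisms are induced by $k,l$ and by $k,l,m$, respectively. The normalisation of an equivalence relation $(R,r_1,r_2)$ on $X$ is the subobject $r_2\circ\ker(r_1)\colon \mathrm{Ker}(r_1)\to X$; $R$ is effective if it is the kernel pair of some morphism. Two equivalence relations $(R,r_1,r_2)$ and $(S,s_1,s_2)$ on $X$, with diagonals $\Delta_R\colon X\to R$ and $\Delta_S\colon X\to S$, Smith-commute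 if there is a morphism $\theta\colon R\times_X S\to X$, defined on the pullback of $r_1$ and $s_2$, such that $\theta\circ\langle 1_R,\Delta_S\circ r_1\rangle=r_2$ and $\theta\circ\langle \Delta_R\circ s_2,1_S\rangle=s_1$. **(1)** Let $R$ and $S$ be effective equivalence relations on an object $X$ of $\mathcal A$, with normalisations $K,L\lhd X$, respectively. Then $R$ and $S$ Smith-commute if and only if $$[K,L]=0=[K,L,X].$$ **(2)** Let $f\colon A\to B$, $r\colon B\to A$, $g\colon C\to B$, $s\colon B\to C$, $\alpha\colon A\to D$, $\beta\colon B\to D$, $\gamma\colon C\to D$ be morphisms of $\mathcal A$ with $f\circ r=1_B=g\circ s$ and $\alpha\circ r=\beta=\gamma\circ s$. Let $\overline K,\overline L,\overline B\leq D$ be the images of $\alpha\circ\ker(f)$, $\gamma\circ\ker(g)$ and $\beta$, respectively. Call $(\alpha,\beta,\gamma)$ admissible with respect to $(f,r,g,s)$ if there is a morphism $\vartheta\colon A\times_B C\to D$ with $\vartheta\circ\langle 1_A,s\circ f\rangle=\alpha$ and $\vartheta\circ\langle r\circ g,1_C\rangle=\gamma$. Then $(\alpha,\beta,\gamma)$ is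 admissible with respect to $(f,r,g,s)$ if and only if $$[\overline K,\overline L]=0=[\overline K,\overline L,\overline B].$$ -/

import Mathlib

open CategoryTheory CategoryTheory.Limits

universe v u

namespace HigginsSmith

section Context

variable (C : Type u) [Category.{v} C] [HasZeroMorphisms C]

/-- Protomodularity of a pointed category with kernels, i.e. the Split Short Five Lemma: for a
morphism `(x, g)` of points (split epimorphisms with a chosen section)
`(p' : X' ⟶ G', s')` to `(p : X ⟶ G, s)`, if the induced morphism between the kernels of `p'` and
`p` and the morphism `g` are isomorphisms, then so is `x`. -/
class Protomodular [HasKernels C] : Prop where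
  splitShortFive : ∀ {X' G' X G : C} (p' : X' ⟶ G') (s' : G' ⟶ X') (p : X ⟶ G) (s : G ⟶ X)
    (x : X' ⟶ X) (g : G' ⟶ G),
    s' ≫ p' = 𝟙 G' → s ≫ p = 𝟙 G → ∀ comm : p' ≫ g = x ≫ p, s' ≫ x = g ≫ s →
    IsIso (kernel.map p' p x g comm) → IsIso g → IsIso x

/-- A homological category: pointed, regular and protomodular. (`Regular` includes the existence of
finite limits.) -/
class HomologicalCategory : Prop extends HasZeroObject C, Regular C, Protomodular C

end Context

section Commutators

variable {C : Type u} [Category.{v} C] [HasZeroMorphisms C]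

section CoSmash

variable [HasFiniteLimits C] [HasFiniteColimits C]

/-- The comparison morphism `X + Y ⟶ X × Y` given by the identity matrix. -/
noncomputable def comparison₂ (X Y : C) : X ⨿ Y ⟶ X ⨯ Y :=
  coprod.desc (prod.lift (𝟙 X) 0) (prod.lift 0 (𝟙 Y))

/-- The inclusion `X ⊗ Y ⟶ X + Y` of the binary co-smash product `X ⊗ Y`, the kernel of
`X + Y ⟶ X × Y`. -/
noncomputable def coSmash₂ι (X Y : C) : kernel (comparison₂ X Y) ⟶ X ⨿ Y :=
  kernel.ι (comparison₂ X Y)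

/-- The comparison morphism `X + Y + Z ⟶ (X + Y) × (X + Z) × (Y + Z)`; the component indexed by a
pair of the three objects is the retraction that sends the third object to zero. -/
noncomputable def comparison₃ (X Y Z : C) : (X ⨿ Y) ⨿ Z ⟶ ((X ⨿ Y) ⨯ (X ⨿ Z)) ⨯ (Y ⨿ Z) :=
  prod.lift
    (prod.lift
      (coprod.desc (coprod.desc coprod.inl coprod.inr) 0)
      (coprod.desc (coprod.desc coprod.inl 0) coprod.inr))
    (coprod.desc (coprod.desc 0 coprod.inl) coprod.inr)

/-- The inclusion `X ⊗ Y ⊗ Z ⟶ X + Y + Z` of the ternary co-smash product `X ⊗ Y ⊗ Z`, the kernel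
of `X + Y + Z ⟶ (X + Y) × (X + Z) × (Y + Z)`. -/
noncomputable def coSmash₃ι (X Y Z : C) : kernel (comparison₃ X Y Z) ⟶ (X ⨿ Y) ⨿ Z :=
  kernel.ι (comparison₃ X Y Z)

variable [HasImages C]

/-- The binary Higgins commutator `[K, L] ≤ X` of two subobjects of `X`: the image of
`K ⊗ L ⟶ K + L ⟶ X`. -/
noncomputable def commutator₂ {X : C} (K L : Subobject X) : Subobject X :=
  imageSubobject (coSmash₂ι (K : C) (L : C) ≫ coprod.desc K.arrow L.arrow)

/-- The ternary commutator `[K, L, M] ≤ X` of three subobjects of `X`: the image of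
`K ⊗ L ⊗ M ⟶ K + L + M ⟶ X`. -/
noncomputable def commutator₃ {X : C} (K L M : Subobject X) : Subobject X :=
  imageSubobject (coSmash₃ι (K : C) (L : C) (M : C) ≫
    coprod.desc (coprod.desc K.arrow L.arrow) M.arrow)

end CoSmash

end Commutators

section Relations

variable {C : Type u} [Category.{v} C]

/-- An (equivalence) relation `r₁, r₂ : R ⟶ X` is effective when it is the kernel pair of some
morphism. -/
def IsEffective {R X : C} (r₁ r₂ : R ⟶ X) : Prop :=
  ∃ (Y : C) (f : X ⟶ Y), IsKernelPair f r₁ r₂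

/-- The diagonal `Δ_R : X ⟶ R` of an equivalence relation `R` on `X`: the (unique) common section
of the two projections. -/
noncomputable def diagonal {R X : C} (r₁ r₂ : R ⟶ X) [h : IsEquivalenceRelation r₁ r₂] : X ⟶ R :=
  h.nonempty_equivalenceRelation.some.r

lemma diagonal_fst {R X : C} (r₁ r₂ : R ⟶ X) [h : IsEquivalenceRelation r₁ r₂] :
    diagonal r₁ r₂ ≫ r₁ = 𝟙 X :=
  h.nonempty_equivalenceRelation.some.reflexivity₁

lemma diagonal_snd {R X : C} (r₁ r₂ : R ⟶ X) [h : IsEquivalenceRelation r₁ r₂] :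
    diagonal r₁ r₂ ≫ r₂ = 𝟙 X :=
  h.nonempty_equivalenceRelation.some.reflexivity₂

/-- The equivalence relations `R` and `S` on `X` Smith-commute: there is a connector
`θ : R ×_X S ⟶ X`, where `R ×_X S` is the pullback of `r₁` and `s₂`, such that
`θ ⟨1_R, Δ_S r₁⟩ = r₂` and `θ ⟨Δ_R s₂, 1_S⟩ = s₁`. -/
def SmithCommute [HasPullbacks C] {R S X : C} (r₁ r₂ : R ⟶ X) (s₁ s₂ : S ⟶ X)
    [IsEquivalenceRelation r₁ r₂] [IsEquivalenceRelation s₁ s₂] : Prop :=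
  ∃ θ : pullback r₁ s₂ ⟶ X,
    pullback.lift (𝟙 R) (r₁ ≫ diagonal s₁ s₂)
      (by rw [Category.assoc, diagonal_snd, Category.id_comp, Category.comp_id]) ≫ θ = r₂ ∧
    pullback.lift (s₂ ≫ diagonal r₁ r₂) (𝟙 S)
      (by rw [Category.assoc, diagonal_fst, Category.id_comp, Category.comp_id]) ≫ θ = s₁

lemma mono_kernel_ι_comp [HasZeroMorphisms C] {R X : C} (r₁ r₂ : R ⟶ X) [HasKernel r₁]
    [h : IsEquivalenceRelation r₁ r₂] : Mono (kernel.ι r₁ ≫ r₂) := by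
  refine ⟨fun a b hab => ?_⟩
  rw [← cancel_mono (kernel.ι r₁)]
  refine h.nonempty_equivalenceRelation.some.right_cancellation _ _ ?_ ?_
  · simp
  · simpa using hab

/-- The normalisation of an equivalence relation `(R, r₁, r₂)` on `X`: the subobject of `X`
represented by the monomorphism `Ker r₁ ⟶ R ⟶ X`, the composite of the kernel of `r₁` with
`r₂`. -/
noncomputable def normalisation [HasZeroMorphisms C] {R X : C} (r₁ r₂ : R ⟶ X) [HasKernel r₁]
    [IsEquivalenceRelation r₁ r₂] : Subobject X :=
  haveI := mono_kernel_ι_comp r₁ r₂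
  Subobject.mk (kernel.ι r₁ ≫ r₂)

/-- Given split epimorphisms `f : A ⟶ B` with section `r` and `g : E ⟶ B` with section `s`, and
morphisms `α : A ⟶ D`, `β : B ⟶ D`, `γ : E ⟶ D` with `α r = β = γ s`, the triple `(α, β, γ)` is
admissible with respect to `(f, r, g, s)` if there is `ϑ : A ×_B E ⟶ D` with `ϑ e₁ = α` and
`ϑ e₂ = γ`, where `e₁ = ⟨1_A, s f⟩` and `e₂ = ⟨r g, 1_E⟩`. -/
def Admissible [HasPullbacks C] {A B E D : C} {f : A ⟶ B} {r : B ⟶ A} {g : E ⟶ B} {s : B ⟶ E}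
    (hf : r ≫ f = 𝟙 B) (hg : s ≫ g = 𝟙 B) {α : A ⟶ D} {β : B ⟶ D} {γ : E ⟶ D}
    (_hα : r ≫ α = β) (_hγ : s ≫ γ = β) : Prop :=
  ∃ ϑ : pullback f g ⟶ D,
    pullback.lift (𝟙 A) (f ≫ s)
      (by rw [Category.assoc, hg, Category.id_comp, Category.comp_id]) ≫ ϑ = α ∧
    pullback.lift (g ≫ r) (𝟙 E)
      (by rw [Category.assoc, hf, Category.id_comp, Category.comp_id]) ≫ ϑ = γ

end Relations

end HigginsSmith

/-! Everything reduces to one condition, `VanishesOnKernel`: the induced map `X + Y + Z ⟶ D` kills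
the kernel `N` of `X + Y + Z ⟶ (X + Z) × (Y + Z)`. Since `N` is a split extension of `X ⊗ Y` by `X ⊗
Y ⊗ Z`, this means that both co-smash products are killed (`vanishesOnKernel_iff`). For the points
`X + Z` and `Y + Z` over `Z`, the pullback is the quotient of `X + Y + Z` by `N`, so admissibility
is exactly this condition. Any point is a strong quotient of such a sum, by protomodularity, and `ϑ`
descends along the quotient (`VanishesOnKernel.admissible`). Passing to images is harmless because
`N` preserves strong epimorphisms (`VanishesOnKernel.of_precomp`). Smith-commutation is a special
case of admissibility. -/

namespace HigginsSmith

attribute [local simp] pullback.lift_fst pullback.lift_snd pullback.lift_fst_assoc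
  pullback.lift_snd_assoc prod.lift_fst prod.lift_snd prod.lift_fst_assoc prod.lift_snd_assoc
  coprod.inl_desc coprod.inr_desc coprod.inl_desc_assoc coprod.inr_desc_assoc
  kernel.lift_ι kernel.lift_ι_assoc

/-! ### Strong epimorphisms in regular categories. -/

section Regular

variable {C : Type u} [Category.{v} C]

/-- If `e` is a strong epimorphism and `e ≫ q` factors through the monomorphism `m`, then so does
`q`. -/
lemma exists_factor_of_strongEpi {X Y Z M : C} (e : X ⟶ Y) [StrongEpi e] (q : Y ⟶ Z) (m : M ⟶ Z)
    [Mono m] (a : X ⟶ M) (h : a ≫ m = e ≫ q) : ∃ b : Y ⟶ M, b ≫ m = q :=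
  have sq : CommSq a e m q := ⟨h⟩
  ⟨sq.lift, sq.fac_right⟩

variable [Regular C]

lemma strongEpi_of_forall_isIso {X Y : C} (f : X ⟶ Y)
    (h : ∀ ⦃M : C⦄ (e : X ⟶ M) (m : M ⟶ Y), e ≫ m = f → ∀ [Mono m], IsIso m) : StrongEpi f :=
  (extremalEpi_iff_strongEpi_of_hasPullbacks f).1 (ExtremalEpi.mk_of_hasEqualizers f h)

lemma strongEpi_of_isPullback {P X Y Z : C} {fst : P ⟶ X} {snd : P ⟶ Y} {f : X ⟶ Z} {g : Y ⟶ Z}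
    (h : IsPullback fst snd f g) [StrongEpi g] : StrongEpi fst := by
  have hg : MorphismProperty.regularEpi C g := by
    rw [MorphismProperty.regularEpi_iff]
    infer_instance
  have hf := Regular.regularEpiIsStableUnderBaseChange.of_isPullback h.flip hg
  rw [MorphismProperty.regularEpi_iff] at hf
  infer_instance

instance strongEpi_pullback_fst {X Y Z : C} (f : X ⟶ Z) (g : Y ⟶ Z) [StrongEpi g] :
    StrongEpi (pullback.fst f g) :=
  strongEpi_of_isPullback (IsPullback.of_hasPullback f g)

lemma strongEpi_coprod_map [HasFiniteColimits C] {X X' Y Y' : C} (f : X ⟶ X') (g : Y ⟶ Y')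
    [StrongEpi f] [StrongEpi g] : StrongEpi (coprod.map f g) := by
  refine strongEpi_of_forall_isIso _ fun M e m hem _ => ?_
  obtain ⟨a, ha⟩ := exists_factor_of_strongEpi f coprod.inl m (coprod.inl ≫ e) (by simp [hem])
  obtain ⟨b, hb⟩ := exists_factor_of_strongEpi g coprod.inr m (coprod.inr ≫ e) (by simp [hem])
  have : (coprod.desc a b) ≫ m = 𝟙 _ := by ext <;> simp [ha, hb]
  have : IsSplitEpi m := ⟨⟨⟨_, this⟩⟩⟩
  exact isIso_of_mono_of_isSplitEpi m

lemma strongEpi_factorThruImageSubobject {X Y : C} (f : X ⟶ Y) :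
    StrongEpi (factorThruImageSubobject f) := by
  unfold factorThruImageSubobject
  infer_instance

end Regular

/-! ### Consequences of protomodularity. -/

section Homological

variable {C : Type u} [Category.{v} C] [HasZeroMorphisms C] [HomologicalCategory C]

/-- The kernel and the section of a split epimorphism are jointly extremal epimorphic. -/
lemma isIso_of_factors_kernel_section {X G M : C} (p : X ⟶ G) (s : G ⟶ X) (hs : s ≫ p = 𝟙 G)
    (m : M ⟶ X) [Mono m] (hk : ∃ a, a ≫ m = kernel.ι p) (hm : ∃ b, b ≫ m = s) : IsIso m := by
  obtain ⟨a, ha⟩ := hk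
  obtain ⟨b, hb⟩ := hm
  have hb' : b ≫ m ≫ p = 𝟙 G := by rw [reassoc_of% hb, hs]
  have hz : a ≫ m ≫ p = 0 := by rw [reassoc_of% ha, kernel.condition]
  refine Protomodular.splitShortFive (m ≫ p) b p s m (𝟙 G) hb' hs (by simp) (by simp [hb]) ?_
    inferInstance
  refine ⟨kernel.lift _ a hz, ?_, ?_⟩
  · rw [← cancel_mono (kernel.ι _), ← cancel_mono m]
    simp [ha]
  · rw [← cancel_mono (kernel.ι _)]
    simp [ha]

/-- The kernel and the section of a split epimorphism are jointly epimorphic. -/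
lemma hom_ext_kernel_section {X G D : C} (p : X ⟶ G) (s : G ⟶ X) (hs : s ≫ p = 𝟙 G) {u v : X ⟶ D}
    (hk : kernel.ι p ≫ u = kernel.ι p ≫ v) (h : s ≫ u = s ≫ v) : u = v := by
  have := isIso_of_factors_kernel_section p s hs (equalizer.ι u v)
    ⟨equalizer.lift _ hk, by simp⟩ ⟨equalizer.lift _ h, by simp⟩
  rw [← cancel_epi (equalizer.ι u v), equalizer.condition]

/-- A strong epimorphism is the cokernel of its kernel. -/
lemma exists_factor_of_kernel_comp_eq_zero {X Y D : C} (q : X ⟶ Y) [StrongEpi q] (φ : X ⟶ D)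
    (h : kernel.ι q ≫ φ = 0) : ∃ ψ : Y ⟶ D, q ≫ ψ = φ := by
  -- The first projection of the kernel pair is split by the diagonal, and its kernel is sent into
  -- `Ker q` by the second projection; hence `φ` equalises the kernel pair.
  have key : pullback.fst q q ≫ φ = pullback.snd q q ≫ φ := by
    refine hom_ext_kernel_section (pullback.fst q q) (pullback.lift (𝟙 X) (𝟙 X) rfl)
      (by simp) ?_ (by simp)
    have hz : (kernel.ι (pullback.fst q q) ≫ pullback.snd q q) ≫ q = 0 := by
      rw [Category.assoc, ← pullback.condition, kernel.condition_assoc, zero_comp]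
    rw [kernel.condition_assoc, zero_comp, ← Category.assoc, ← kernel.lift_ι q _ hz,
      Category.assoc, h, comp_zero]
  have hw : IsRegularEpi.left q ≫ φ = IsRegularEpi.right q ≫ φ := by
    have := congrArg (pullback.lift _ _ (IsRegularEpi.w q) ≫ ·) key
    simpa using this
  exact ⟨IsRegularEpi.desc q φ hw, IsRegularEpi.fac q φ hw⟩

/-- The two product inclusions are jointly epimorphic. -/
lemma prod_hom_ext_of_inclusions {X Y D : C} {u v : X ⨯ Y ⟶ D}
    (hl : prod.lift (𝟙 X) 0 ≫ u = prod.lift (𝟙 X) 0 ≫ v)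
    (hr : prod.lift 0 (𝟙 Y) ≫ u = prod.lift 0 (𝟙 Y) ≫ v) : u = v := by
  refine hom_ext_kernel_section prod.fst (prod.lift (𝟙 X) 0) (by simp) ?_ hl
  have : kernel.ι prod.fst = (kernel.ι prod.fst ≫ prod.snd) ≫ prod.lift (0 : Y ⟶ X) (𝟙 Y) := by
    ext <;> simp
  rw [this]
  simp only [Category.assoc, hr]

/-- A monomorphism through which the kernel of `π` factors, and whose composite with `π` is a strong
epimorphism, is an isomorphism. -/
lemma isIso_of_factors_kernel {I Q X : C} (m : I ⟶ Q) [Mono m] (π : Q ⟶ X) [StrongEpi (m ≫ π)]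
    (h : ∃ a, a ≫ m = kernel.ι π) : IsIso m := by
  obtain ⟨a, ha⟩ := h
  -- Pulling `π` back along `m ≫ π` yields an epimorphism split by `d`. The pullback of `m` to this
  -- point contains its kernel and section, hence is everything.
  let d : I ⟶ pullback π (m ≫ π) := pullback.lift m (𝟙 I) (by simp)
  have hz : (kernel.ι (pullback.snd π (m ≫ π)) ≫ pullback.fst π (m ≫ π)) ≫ π = 0 := by
    rw [Category.assoc, pullback.condition, kernel.condition_assoc, zero_comp]
  have hiso : IsIso (pullback.fst (pullback.fst π (m ≫ π)) m) := by
    refine isIso_of_factors_kernel_section (pullback.snd π (m ≫ π)) d (by simp [d]) _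
      ⟨pullback.lift (kernel.ι _) (kernel.lift π _ hz ≫ a) (by simp [ha]), by simp⟩
      ⟨pullback.lift d (𝟙 I) (by simp [d]), by simp⟩
  let t := inv (pullback.fst (pullback.fst π (m ≫ π)) m) ≫ pullback.snd (pullback.fst π (m ≫ π)) m
  have ht : t ≫ m = pullback.fst π (m ≫ π) := by
    rw [Category.assoc, ← pullback.condition, IsIso.inv_hom_id_assoc]
  have : StrongEpi (t ≫ m) := ht ▸ inferInstance
  have := strongEpi_of_strongEpi t m
  exact isIso_of_mono_of_strongEpi m

/-- Taking kernels of split epimorphisms preserves strong epimorphisms. -/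
lemma strongEpi_kernel_map {X' G' X G : C} (p' : X' ⟶ G') (s' : G' ⟶ X') (p : X ⟶ G) (s : G ⟶ X)
    (x : X' ⟶ X) (g : G' ⟶ G) (hs' : s' ≫ p' = 𝟙 G') (comm : p' ≫ g = x ≫ p)
    (hsx : s' ≫ x = g ≫ s) [StrongEpi x] [StrongEpi g] :
    StrongEpi (kernel.map p' p x g comm) := by
  let h : X' ⟶ pullback p g := pullback.lift x p' comm.symm
  have hh : StrongEpi h := by
    -- In terms of elements, `(0, y)` with `g y = 0` equals `h (s' y)`, so `M` contains the kernel
    -- of the first projection.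
    refine strongEpi_of_forall_isIso _ fun M e m hem _ => ?_
    have : StrongEpi (e ≫ m ≫ pullback.fst p g) := by
      rw [reassoc_of% hem]
      simpa [h]
    have := strongEpi_of_strongEpi e (m ≫ pullback.fst p g)
    refine isIso_of_factors_kernel m (pullback.fst p g)
      ⟨kernel.ι (pullback.fst p g) ≫ pullback.snd p g ≫ s' ≫ e, ?_⟩
    simp only [Category.assoc, hem]
    ext
    · simp only [Category.assoc, h, pullback.lift_fst, kernel.condition, hsx]
      rw [← pullback.condition_assoc, kernel.condition_assoc, zero_comp]
    · simp [h, hs']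
  -- The map between kernels is a base change of `h`.
  have hp : IsPullback (kernel.map p' p x g comm) (kernel.ι p')
      (pullback.lift (kernel.ι p) 0 (by simp) : _ ⟶ pullback p g) h := by
    refine ⟨⟨?_⟩, ⟨PullbackCone.IsLimit.mk _
      (fun c => kernel.lift p' c.snd ?_) ?_ ?_ ?_⟩⟩
    · ext <;> simp [h]
    · simpa [h] using (congrArg (· ≫ pullback.snd p g) c.condition).symm
    · intro c
      rw [← cancel_mono (kernel.ι p)]
      simpa [h] using (congrArg (· ≫ pullback.fst p g) c.condition).symm
    · intro c
      simp
    · intro c m _ h2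
      rw [← cancel_mono (kernel.ι p')]
      simp [h2]
  exact strongEpi_of_isPullback hp

end Homological

/-! ### The kernel condition on sums and its relation to co-smash products. -/

section VanishesOnKernel

variable {C : Type u} [Category.{v} C] [HasZeroMorphisms C]

/-- The retraction `X + Y + Z ⟶ X + Z` that sends `Y` to zero. -/
noncomputable def retrFst [HasFiniteColimits C] (X Y Z : C) : (X ⨿ Y) ⨿ Z ⟶ X ⨿ Z :=
  coprod.desc (coprod.desc coprod.inl 0) coprod.inr

/-- The retraction `X + Y + Z ⟶ Y + Z` that sends `X` to zero. -/
noncomputable def retrSnd [HasFiniteColimits C] (X Y Z : C) : (X ⨿ Y) ⨿ Z ⟶ Y ⨿ Z :=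
  coprod.desc (coprod.desc 0 coprod.inl) coprod.inr

/-- The morphism `X + Y + Z ⟶ D` induced by `a`, `b`, `c` vanishes on the kernel of the
comparison `X + Y + Z ⟶ (X + Z) × (Y + Z)`. -/
def VanishesOnKernel [HasFiniteColimits C] {X Y Z D : C} (a : X ⟶ D) (b : Y ⟶ D) (c : Z ⟶ D) :
    Prop :=
  ∀ ⦃T : C⦄ (t : T ⟶ (X ⨿ Y) ⨿ Z), t ≫ retrFst X Y Z = 0 → t ≫ retrSnd X Y Z = 0 →
    t ≫ coprod.desc (coprod.desc a b) c = 0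

variable [HasFiniteColimits C]

lemma coprod_map_map_comp_retrFst {X X' Y Y' Z Z' : C} (x : X ⟶ X') (y : Y ⟶ Y') (z : Z ⟶ Z') :
    coprod.map (coprod.map x y) z ≫ retrFst X' Y' Z' = retrFst X Y Z ≫ coprod.map x z := by
  ext <;> simp [retrFst]

lemma coprod_map_map_comp_retrSnd {X X' Y Y' Z Z' : C} (x : X ⟶ X') (y : Y ⟶ Y') (z : Z ⟶ Z') :
    coprod.map (coprod.map x y) z ≫ retrSnd X' Y' Z' = retrSnd X Y Z ≫ coprod.map y z := by
  ext <;> simp [retrSnd]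

lemma VanishesOnKernel.precomp {X X' Y Y' Z Z' D : C} {a : X' ⟶ D} {b : Y' ⟶ D} {c : Z' ⟶ D}
    (h : VanishesOnKernel a b c) (x : X ⟶ X') (y : Y ⟶ Y') (z : Z ⟶ Z') :
    VanishesOnKernel (x ≫ a) (y ≫ b) (z ≫ c) := by
  intro T t h₁ h₂
  have := h (t ≫ coprod.map (coprod.map x y) z)
    (by rw [Category.assoc, coprod_map_map_comp_retrFst, reassoc_of% h₁, zero_comp])
    (by rw [Category.assoc, coprod_map_map_comp_retrSnd, reassoc_of% h₂, zero_comp])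
  simpa using this

variable [HomologicalCategory C]

/-- Vanishing on the kernel can be tested after precomposition with strong epimorphisms. -/
lemma VanishesOnKernel.of_precomp {X X' Y Y' Z Z' D : C} {a : X' ⟶ D} {b : Y' ⟶ D} {c : Z' ⟶ D}
    (x : X ⟶ X') (y : Y ⟶ Y') (z : Z ⟶ Z') [StrongEpi x] [StrongEpi y] [StrongEpi z]
    (h : VanishesOnKernel (x ≫ a) (y ≫ b) (z ≫ c)) : VanishesOnKernel a b c := by
  have := strongEpi_coprod_map x y
  have := strongEpi_coprod_map x z
  have := strongEpi_coprod_map y z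
  have := strongEpi_coprod_map (coprod.map x y) z
  let π (U V : C) : U ⨿ V ⟶ V := coprod.desc 0 (𝟙 V)
  have hπ (U V W : C) : retrFst U V W ≫ π U W = retrSnd U V W ≫ π V W := by
    ext <;> simp [retrFst, retrSnd, π]
  have hσ (U V W : C) : π V W ≫ coprod.inr = coprod.map coprod.inr (𝟙 W) ≫ retrFst U V W := by
    ext <;> simp [retrFst, π]
  have hx (U V W : C) : coprod.map coprod.inl (𝟙 W) ≫ retrFst U V W = 𝟙 _ := by
    ext <;> simp [retrFst]
  have hy (U V W : C) : coprod.map coprod.inr (𝟙 W) ≫ retrSnd U V W = 𝟙 _ := by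
    ext <;> simp [retrSnd]
  -- `Ker ρ` is the kernel of the comparison to the product, obtained by taking kernels of naturally
  -- split epimorphisms twice. So `strongEpi_kernel_map` applies twice.
  let ρ (U V W : C) : kernel (retrFst U V W) ⟶ kernel (π V W) :=
    kernel.map _ _ (retrSnd U V W) (π U W) (hπ U V W)
  let σ (U V W : C) : kernel (π V W) ⟶ kernel (retrFst U V W) :=
    kernel.map _ _ (coprod.map coprod.inr (𝟙 W)) coprod.inr (hσ U V W)
  have hρ (U V W : C) : σ U V W ≫ ρ U V W = 𝟙 _ := by
    rw [← cancel_mono (kernel.ι _)]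
    simp [ρ, σ, hy]
  have hyz : π Y Z ≫ z = coprod.map y z ≫ π Y' Z' := by ext <;> simp [π]
  let κ : kernel (retrFst X Y Z) ⟶ kernel (retrFst X' Y' Z') :=
    kernel.map _ _ _ _ (coprod_map_map_comp_retrFst x y z).symm
  have : StrongEpi κ := strongEpi_kernel_map _ (coprod.map coprod.inl (𝟙 Z)) _
    (coprod.map coprod.inl (𝟙 Z')) _ _ (hx X Y Z) _ (by ext <;> simp)
  let μ : kernel (π Y Z) ⟶ kernel (π Y' Z') := kernel.map _ _ _ _ hyz
  have : StrongEpi μ := strongEpi_kernel_map _ coprod.inr _ coprod.inr _ _ (by simp [π]) _ (by simp)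
  have hκμ : ρ X Y Z ≫ μ = κ ≫ ρ X' Y' Z' := by
    rw [← cancel_mono (kernel.ι _)]
    simp [ρ, μ, κ, coprod_map_map_comp_retrSnd]
  have : StrongEpi (kernel.map _ _ κ μ hκμ) := by
    refine strongEpi_kernel_map _ (σ X Y Z) _ (σ X' Y' Z') _ _ (hρ X Y Z) _ ?_
    rw [← cancel_mono (kernel.ι _)]
    simp only [σ, μ, κ, Category.assoc, kernel.lift_ι, kernel.lift_ι_assoc]
    congr 1
    ext <;> simp
  have key : kernel.ι (ρ X' Y' Z') ≫ kernel.ι (retrFst X' Y' Z') ≫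
      coprod.desc (coprod.desc a b) c = 0 := by
    rw [← cancel_epi (kernel.map _ _ κ μ hκμ)]
    have h₀ := h (kernel.ι (ρ X Y Z) ≫ kernel.ι (retrFst X Y Z)) (by simp) (by
      have hι : ρ X Y Z ≫ kernel.ι (π Y Z) = kernel.ι (retrFst X Y Z) ≫ retrSnd X Y Z :=
        kernel.lift_ι _ _ _
      rw [Category.assoc, ← hι, kernel.condition_assoc, zero_comp])
    simpa [κ] using h₀
  intro T t h₁ h₂
  have ht : kernel.lift _ t h₁ ≫ ρ X' Y' Z' = 0 := by
    rw [← cancel_mono (kernel.ι _)]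
    simp [ρ, h₂]
  have := congrArg (kernel.lift _ _ ht ≫ ·) key
  simpa using this

/-- The kernel of `X + Y + Z ⟶ (X + Z) × (Y + Z)` is a split extension of `X ⊗ Y` by
`X ⊗ Y ⊗ Z`, so vanishing on it can be tested on these two. -/
lemma vanishesOnKernel_iff {X Y Z D : C} (a : X ⟶ D) (b : Y ⟶ D) (c : Z ⟶ D) :
    VanishesOnKernel a b c ↔ coSmash₂ι X Y ≫ coprod.desc a b = 0 ∧
      coSmash₃ι X Y Z ≫ coprod.desc (coprod.desc a b) c = 0 := by
  have hr₁ : coprod.inl ≫ retrFst X Y Z = comparison₂ X Y ≫ prod.fst ≫ coprod.inl := by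
    ext <;> simp [retrFst, comparison₂]
  have hr₂ : coprod.inl ≫ retrSnd X Y Z = comparison₂ X Y ≫ prod.snd ≫ coprod.inl := by
    ext <;> simp [retrSnd, comparison₂]
  constructor
  · intro h
    constructor
    · have := h (coSmash₂ι X Y ≫ coprod.inl) (by simp [hr₁, coSmash₂ι]) (by simp [hr₂, coSmash₂ι])
      simpa using this
    · have h₁ : comparison₃ X Y Z ≫ prod.fst ≫ prod.snd = retrFst X Y Z := by
        simp [comparison₃, retrFst]
      have h₂ : comparison₃ X Y Z ≫ prod.snd = retrSnd X Y Z := by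
        simp [comparison₃, retrSnd]
      refine h _ ?_ ?_
      · rw [← h₁, coSmash₃ι, kernel.condition_assoc, zero_comp]
      · rw [← h₂, coSmash₃ι, kernel.condition_assoc, zero_comp]
  · rintro ⟨h₂, h₃⟩
    let q := prod.lift (retrFst X Y Z) (retrSnd X Y Z)
    let p : (X ⨿ Y) ⨿ Z ⟶ X ⨿ Y := coprod.desc (𝟙 _) 0
    have hq₁ : kernel.ι q ≫ retrFst X Y Z = 0 := by
      simpa [q] using congrArg (· ≫ prod.fst) (kernel.condition q)
    have hq₂ : kernel.ι q ≫ retrSnd X Y Z = 0 := by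
      simpa [q] using congrArg (· ≫ prod.snd) (kernel.condition q)
    have hp₁ : p ≫ comparison₂ X Y ≫ prod.fst = retrFst X Y Z ≫ coprod.desc (𝟙 X) 0 := by
      ext <;> simp [p, comparison₂, retrFst]
    have hp₂ : p ≫ comparison₂ X Y ≫ prod.snd = retrSnd X Y Z ≫ coprod.desc (𝟙 Y) 0 := by
      ext <;> simp [p, comparison₂, retrSnd]
    have hc : comparison₃ X Y Z = prod.lift (prod.lift p (retrFst X Y Z)) (retrSnd X Y Z) := by
      simp only [comparison₃, retrFst, retrSnd, p]
      congr
      ext <;> simp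
    -- On `Ker q`, `p` lands in `X ⊗ Y`; by `hc`, the kernel of this restriction is `X ⊗ Y ⊗ Z`. It
    -- is split by `σ`, whence the split extension.
    let h : kernel q ⟶ kernel (comparison₂ X Y) := kernel.lift _ (kernel.ι q ≫ p) (by
      ext
      · simp only [Category.assoc, hp₁, reassoc_of% hq₁, zero_comp]
      · simp only [Category.assoc, hp₂, reassoc_of% hq₂, zero_comp])
    let σ : kernel (comparison₂ X Y) ⟶ kernel q := kernel.lift _ (coSmash₂ι X Y ≫ coprod.inl) (by
      ext <;> simp [q, hr₁, hr₂, coSmash₂ι])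
    have key : kernel.ι q ≫ coprod.desc (coprod.desc a b) c = 0 := by
      refine hom_ext_kernel_section h σ ?_ ?_ ?_
      · rw [← cancel_mono (kernel.ι _)]
        simp [h, σ, coSmash₂ι, p]
      · have hh : kernel.ι h ≫ kernel.ι q ≫ p = 0 := by
          have hι : h ≫ kernel.ι (comparison₂ X Y) = kernel.ι q ≫ p := kernel.lift_ι _ _ _
          rw [← hι, kernel.condition_assoc, zero_comp]
        have hz : (kernel.ι h ≫ kernel.ι q) ≫ comparison₃ X Y Z = 0 := by
          rw [hc]
          ext <;> simp [hh, hq₁, hq₂]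
        have := congrArg (kernel.lift _ _ hz ≫ ·) h₃
        simpa [coSmash₃ι] using this
      · simpa [σ] using h₂
    intro T t ht₁ ht₂
    have ht : t ≫ q = 0 := by ext <;> simp [q, ht₁, ht₂]
    simpa using congrArg (kernel.lift _ _ ht ≫ ·) key

end VanishesOnKernel

/-! ### Admissibility as a kernel condition. -/

section Admissible

variable {C : Type u} [Category.{v} C]

section PullbackInclusions

variable [HasPullbacks C] {A B E : C} {f : A ⟶ B} {r : B ⟶ A} {g : E ⟶ B} {s : B ⟶ E}

/-- The inclusion `⟨1, s f⟩ : A ⟶ A ×_B E` for split epimorphisms `f` and `g`. -/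
noncomputable abbrev pullbackInl (f : A ⟶ B) (hg : s ≫ g = 𝟙 B) : A ⟶ pullback f g :=
  pullback.lift (𝟙 A) (f ≫ s) (by rw [Category.assoc, hg, Category.id_comp, Category.comp_id])

/-- The inclusion `⟨r g, 1⟩ : E ⟶ A ×_B E` for split epimorphisms `f` and `g`. -/
noncomputable abbrev pullbackInr (hf : r ≫ f = 𝟙 B) (g : E ⟶ B) : E ⟶ pullback f g :=
  pullback.lift (g ≫ r) (𝟙 E) (by rw [Category.assoc, hf, Category.id_comp, Category.comp_id])

end PullbackInclusions

variable [HasZeroMorphisms C] [HomologicalCategory C]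

variable {A B E D : C} {f : A ⟶ B} {r : B ⟶ A} {g : E ⟶ B} {s : B ⟶ E}

/-- The inclusions of two points over `B` into their product are jointly extremal epimorphic. -/
lemma isIso_of_factors_pullback_inclusions (hf : r ≫ f = 𝟙 B) (hg : s ≫ g = 𝟙 B) {M : C}
    (m : M ⟶ pullback f g) [Mono m] (hl : ∃ a, a ≫ m = pullbackInl f hg)
    (hr : ∃ b, b ≫ m = pullbackInr hf g) : IsIso m := by
  refine isIso_of_factors_kernel_section (pullback.fst f g) (pullbackInl f hg) (by simp) m ?_ hl
  obtain ⟨b, hb⟩ := hr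
  refine ⟨kernel.ι (pullback.fst f g) ≫ pullback.snd f g ≫ b, ?_⟩
  simp only [Category.assoc, hb]
  ext
  · simp [← pullback.condition_assoc]
  · simp

variable [HasFiniteColimits C]

lemma strongEpi_desc_kernel_section (hf : r ≫ f = 𝟙 B) : StrongEpi (coprod.desc (kernel.ι f) r) :=
  strongEpi_of_forall_isIso _ fun _ e m hem _ => isIso_of_factors_kernel_section f r hf m
    ⟨coprod.inl ≫ e, by simp [hem]⟩ ⟨coprod.inr ≫ e, by simp [hem]⟩

/-- The induced map to `D` factors as `q ≫ ϑ`, and the components of `q` factor through the two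
retractions. -/
lemma Admissible.vanishesOnKernel {hf : r ≫ f = 𝟙 B} {hg : s ≫ g = 𝟙 B} {α : A ⟶ D} {β : B ⟶ D}
    {γ : E ⟶ D} {hα : r ≫ α = β} {hγ : s ≫ γ = β} (h : Admissible hf hg hα hγ) :
    VanishesOnKernel (kernel.ι f ≫ α) (kernel.ι g ≫ γ) β := by
  obtain ⟨ϑ, h₁, h₂⟩ := h
  let q : (kernel f ⨿ kernel g) ⨿ B ⟶ pullback f g :=
    pullback.lift (retrFst _ _ _ ≫ coprod.desc (kernel.ι f) r)
      (retrSnd _ _ _ ≫ coprod.desc (kernel.ι g) s) (by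
        ext <;> simp [retrFst, retrSnd, hf, hg])
  have hq : coprod.desc (coprod.desc (kernel.ι f ≫ α) (kernel.ι g ≫ γ)) β = q ≫ ϑ := by
    rw [← hα, ← h₁, ← h₂]
    have e₁ : (coprod.inl ≫ coprod.inl) ≫ q = kernel.ι f ≫ pullbackInl f hg := by
      ext <;> simp [q, retrFst, retrSnd]
    have e₂ : (coprod.inr ≫ coprod.inl) ≫ q = kernel.ι g ≫ pullbackInr hf g := by
      ext <;> simp [q, retrFst, retrSnd]
    have e₃ : coprod.inr ≫ q = r ≫ pullbackInl f hg := by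
      ext <;> simp [q, retrFst, retrSnd, reassoc_of% hf]
    ext
    · simpa using (congrArg (· ≫ ϑ) e₁).symm
    · simpa using (congrArg (· ≫ ϑ) e₂).symm
    · simpa using (congrArg (· ≫ ϑ) e₃).symm
  intro T t ht₁ ht₂
  have : t ≫ q = 0 := by
    ext
    · simp [q, reassoc_of% ht₁]
    · simp [q, reassoc_of% ht₂]
  rw [hq, reassoc_of% this, zero_comp]

/-- The canonical `q` to the pullback is a strong epimorphism, since its image contains both
inclusions. Hence `q` is the cokernel of its kernel, which both retractions kill. -/
lemma VanishesOnKernel.admissible_coprod {X Y Z : C} {a : X ⟶ D} {b : Y ⟶ D} {c : Z ⟶ D}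
    (h : VanishesOnKernel a b c) :
    Admissible (f := coprod.desc (0 : X ⟶ Z) (𝟙 Z)) (r := coprod.inr)
      (g := coprod.desc (0 : Y ⟶ Z) (𝟙 Z)) (s := coprod.inr) (by simp) (by simp)
      (α := coprod.desc a c) (β := c) (γ := coprod.desc b c) (by simp) (by simp) := by
  let p : X ⨿ Z ⟶ Z := coprod.desc 0 (𝟙 Z)
  let p' : Y ⨿ Z ⟶ Z := coprod.desc 0 (𝟙 Z)
  have hp : coprod.inr ≫ p = 𝟙 Z := by simp [p]
  have hp' : coprod.inr ≫ p' = 𝟙 Z := by simp [p']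
  let q : (X ⨿ Y) ⨿ Z ⟶ pullback p p' := pullback.lift (retrFst X Y Z) (retrSnd X Y Z) (by
    ext <;> simp [retrFst, retrSnd, p, p'])
  have hq₁ : coprod.map coprod.inl (𝟙 Z) ≫ q = pullbackInl p hp' := by
    ext <;> simp [q, retrFst, retrSnd, p]
  have hq₂ : coprod.map coprod.inr (𝟙 Z) ≫ q = pullbackInr hp p' := by
    ext <;> simp [q, retrFst, retrSnd, p']
  have : StrongEpi q := strongEpi_of_forall_isIso _ fun M e m hem _ =>
    isIso_of_factors_pullback_inclusions hp hp' m ⟨coprod.map coprod.inl (𝟙 Z) ≫ e, by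
      rw [Category.assoc, hem, hq₁]⟩ ⟨coprod.map coprod.inr (𝟙 Z) ≫ e, by
      rw [Category.assoc, hem, hq₂]⟩
  obtain ⟨ψ, hψ⟩ := exists_factor_of_kernel_comp_eq_zero q (coprod.desc (coprod.desc a b) c)
    (h _ (by
      have hq : q ≫ pullback.fst p p' = retrFst X Y Z := pullback.lift_fst _ _ _
      rw [← hq, kernel.condition_assoc, zero_comp]) (by
      have hq : q ≫ pullback.snd p p' = retrSnd X Y Z := pullback.lift_snd _ _ _
      rw [← hq, kernel.condition_assoc, zero_comp]))
  refine ⟨ψ, ?_, ?_⟩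
  · change pullbackInl p hp' ≫ ψ = _
    rw [← hq₁, Category.assoc, hψ]
    ext <;> simp
  · change pullbackInr hp p' ≫ ψ = _
    rw [← hq₂, Category.assoc, hψ]
    ext <;> simp

/-- The sum case gives `ψ` on the pullback of `kernel f ⨿ B` and `kernel g ⨿ B`, which covers `A ×_B
E` by a strong epimorphism `t`. It remains to see that `ψ` kills `Ker t`. -/
lemma VanishesOnKernel.admissible (hf : r ≫ f = 𝟙 B) (hg : s ≫ g = 𝟙 B) {α : A ⟶ D} {β : B ⟶ D}
    {γ : E ⟶ D} (hα : r ≫ α = β) (hγ : s ≫ γ = β)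
    (h : VanishesOnKernel (kernel.ι f ≫ α) (kernel.ι g ≫ γ) β) : Admissible hf hg hα hγ := by
  obtain ⟨ψ, h₁, h₂⟩ := h.admissible_coprod
  let p : kernel f ⨿ B ⟶ B := coprod.desc 0 (𝟙 B)
  let p' : kernel g ⨿ B ⟶ B := coprod.desc 0 (𝟙 B)
  have hp : coprod.inr ≫ p = 𝟙 B := by simp [p]
  have hp' : coprod.inr ≫ p' = 𝟙 B := by simp [p']
  let κ : kernel f ⨿ B ⟶ A := coprod.desc (kernel.ι f) r
  let μ : kernel g ⨿ B ⟶ E := coprod.desc (kernel.ι g) s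
  have : StrongEpi κ := strongEpi_desc_kernel_section hf
  have : StrongEpi μ := strongEpi_desc_kernel_section hg
  have hκ : κ ≫ f = p := by ext <;> simp [κ, p, hf]
  have hμ : μ ≫ g = p' := by ext <;> simp [μ, p', hg]
  have hα' : coprod.desc (kernel.ι f ≫ α) β = κ ≫ α := by ext <;> simp [κ, hα]
  have hγ' : coprod.desc (kernel.ι g ≫ γ) β = μ ≫ γ := by ext <;> simp [μ, hγ]
  change pullbackInl p hp' ≫ ψ = _ at h₁
  change pullbackInr hp p' ≫ ψ = _ at h₂
  rw [hα'] at h₁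
  rw [hγ'] at h₂
  let t : pullback p p' ⟶ pullback f g :=
    pullback.lift (pullback.fst p p' ≫ κ) (pullback.snd p p' ≫ μ) (by
      simp [hκ, hμ, pullback.condition])
  have ht_fst : t ≫ pullback.fst f g = pullback.fst p p' ≫ κ := pullback.lift_fst _ _ _
  have ht_snd : t ≫ pullback.snd f g = pullback.snd p p' ≫ μ := pullback.lift_snd _ _ _
  have ht₁ : pullbackInl p hp' ≫ t = κ ≫ pullbackInl f hg := by
    apply pullback.hom_ext
    · simp [t]
    · simp [t, μ, reassoc_of% hκ]
  have ht₂ : pullbackInr hp p' ≫ t = μ ≫ pullbackInr hf g := by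
    apply pullback.hom_ext
    · simp [t, κ, reassoc_of% hμ]
    · simp [t]
  have : StrongEpi t := strongEpi_of_forall_isIso _ fun M e m hem _ =>
    isIso_of_factors_pullback_inclusions hf hg m
      (exists_factor_of_strongEpi κ _ m (pullbackInl p hp' ≫ e) (by
        rw [Category.assoc, hem, ht₁]))
      (exists_factor_of_strongEpi μ _ m (pullbackInr hp p' ≫ e) (by
        rw [Category.assoc, hem, ht₂]))
  have hzκ : kernel.ι t ≫ pullback.fst p p' ≫ κ = 0 := by
    rw [← ht_fst, kernel.condition_assoc, zero_comp]
  have hzμ : kernel.ι t ≫ pullback.snd p p' ≫ μ = 0 := by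
    rw [← ht_snd, kernel.condition_assoc, zero_comp]
  -- `Ker t` factors through this product. On each factor `ψ` restricts to `κ ≫ α` or `μ ≫ γ`, hence
  -- vanishes, and the two factors are jointly epimorphic.
  let c : kernel κ ⨯ kernel μ ⟶ pullback p p' :=
    pullback.lift (prod.fst ≫ kernel.ι κ) (prod.snd ≫ kernel.ι μ) (by simp [← hκ, ← hμ])
  have hc : c ≫ ψ = 0 := by
    have e₁ : prod.lift (𝟙 _) 0 ≫ c = kernel.ι κ ≫ pullbackInl p hp' := by
      ext <;> simp [c, ← hκ]
    have e₂ : prod.lift 0 (𝟙 _) ≫ c = kernel.ι μ ≫ pullbackInr hp p' := by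
      ext <;> simp [c, ← hμ]
    refine prod_hom_ext_of_inclusions ?_ ?_
    · rw [reassoc_of% e₁, h₁, kernel.condition_assoc, zero_comp, comp_zero]
    · rw [reassoc_of% e₂, h₂, kernel.condition_assoc, zero_comp, comp_zero]
  have hz : kernel.ι t = prod.lift (kernel.lift κ (kernel.ι t ≫ pullback.fst p p') (by simpa))
      (kernel.lift μ (kernel.ι t ≫ pullback.snd p p') (by simpa)) ≫ c := by
    ext <;> simp [c]
  obtain ⟨ϑ, hϑ⟩ := exists_factor_of_kernel_comp_eq_zero t ψ (by
    rw [hz, Category.assoc, hc, comp_zero])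
  refine ⟨ϑ, ?_, ?_⟩
  · rw [← cancel_epi κ, ← h₁, ← hϑ, reassoc_of% ht₁]
  · rw [← cancel_epi μ, ← h₂, ← hϑ, reassoc_of% ht₂]

lemma imageSubobject_eq_bot_iff {X Y : C} (h : X ⟶ Y) : imageSubobject h = ⊥ ↔ h = 0 := by
  constructor
  · intro hh
    rw [← Subobject.bot_factors_iff_zero, ← hh]
    exact (Subobject.mk_factors_iff _ _).2 ⟨factorThruImage h, image.fac h⟩
  · rintro rfl
    exact imageSubobject_zero

/-- From images back to the original maps is naturality (`precomp`); the other direction needs the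
strong epimorphisms onto the images (`of_precomp`). -/
lemma admissible_iff (hf : r ≫ f = 𝟙 B) (hg : s ≫ g = 𝟙 B) {α : A ⟶ D} {β : B ⟶ D}
    {γ : E ⟶ D} (hα : r ≫ α = β) (hγ : s ≫ γ = β) :
    Admissible hf hg hα hγ ↔
      commutator₂ (imageSubobject (kernel.ι f ≫ α)) (imageSubobject (kernel.ι g ≫ γ)) = ⊥ ∧
      commutator₃ (imageSubobject (kernel.ι f ≫ α)) (imageSubobject (kernel.ι g ≫ γ))
        (imageSubobject β) = ⊥ := by
  rw [commutator₂, commutator₃, imageSubobject_eq_bot_iff, imageSubobject_eq_bot_iff,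
    ← vanishesOnKernel_iff]
  constructor
  · intro h
    have := strongEpi_factorThruImageSubobject (kernel.ι f ≫ α)
    have := strongEpi_factorThruImageSubobject (kernel.ι g ≫ γ)
    have := strongEpi_factorThruImageSubobject β
    refine VanishesOnKernel.of_precomp (factorThruImageSubobject (kernel.ι f ≫ α))
      (factorThruImageSubobject (kernel.ι g ≫ γ)) (factorThruImageSubobject β) ?_
    simpa only [imageSubobject_arrow_comp] using h.vanishesOnKernel
  · intro h
    have := h.precomp (factorThruImageSubobject (kernel.ι f ≫ α))
      (factorThruImageSubobject (kernel.ι g ≫ γ)) (factorThruImageSubobject β)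
    simp only [imageSubobject_arrow_comp] at this
    exact this.admissible hf hg hα hγ

end Admissible

/-! ### Normalising through either projection. -/

section Normalisation

variable {C : Type u} [Category.{v} C] [HasZeroMorphisms C]

/-- The two ways of normalising an equivalence relation agree. -/
lemma normalisation_eq_mk_kernel_snd {R X : C} (r₁ r₂ : R ⟶ X) [HasKernel r₁] [HasKernel r₂]
    [h : IsEquivalenceRelation r₁ r₂] [Mono (kernel.ι r₂ ≫ r₁)] :
    normalisation r₁ r₂ = Subobject.mk (kernel.ι r₂ ≫ r₁) := by
  have := mono_kernel_ι_comp r₁ r₂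
  let e := h.nonempty_equivalenceRelation.some
  refine le_antisymm (Subobject.mk_le_mk_of_comm (kernel.lift r₂ (kernel.ι r₁ ≫ e.s) ?_) ?_)
    (Subobject.mk_le_mk_of_comm (kernel.lift r₁ (kernel.ι r₂ ≫ e.s) ?_) ?_)
  · rw [Category.assoc, e.symmetry₂, kernel.condition]
  · rw [kernel.lift_ι_assoc, Category.assoc, e.symmetry₁]
  · rw [Category.assoc, e.symmetry₁, kernel.condition]
  · rw [kernel.lift_ι_assoc, Category.assoc, e.symmetry₂]

lemma mono_kernel_ι_snd_comp_fst {R X : C} (r₁ r₂ : R ⟶ X) [HasKernel r₂]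
    [h : IsEquivalenceRelation r₁ r₂] : Mono (kernel.ι r₂ ≫ r₁) := by
  refine ⟨fun a b hab => ?_⟩
  rw [← cancel_mono (kernel.ι r₂)]
  refine h.nonempty_equivalenceRelation.some.right_cancellation _ _ ?_ ?_
  · simpa using hab
  · simp

end Normalisation

end HigginsSmith

open HigginsSmith in
theorem theorem4p4 {C : Type u} [Category.{v} C] [HasZeroMorphisms C] [HomologicalCategory C]
    [HasFiniteColimits C] :
    (∀ (X R S : C) (r₁ r₂ : R ⟶ X) (s₁ s₂ : S ⟶ X)
      [IsEquivalenceRelation r₁ r₂] [IsEquivalenceRelation s₁ s₂],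
      IsEffective r₁ r₂ → IsEffective s₁ s₂ →
      (SmithCommute r₁ r₂ s₁ s₂ ↔
        commutator₂ (normalisation r₁ r₂) (normalisation s₁ s₂) = ⊥ ∧
        commutator₃ (normalisation r₁ r₂) (normalisation s₁ s₂) ⊤ = ⊥)) ∧
    (∀ (A B E D : C) (f : A ⟶ B) (r : B ⟶ A) (g : E ⟶ B) (s : B ⟶ E)
      (α : A ⟶ D) (β : B ⟶ D) (γ : E ⟶ D)
      (hf : r ≫ f = 𝟙 B) (hg : s ≫ g = 𝟙 B) (hα : r ≫ α = β) (hγ : s ≫ γ = β),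
      Admissible hf hg hα hγ ↔
        commutator₂ (imageSubobject (kernel.ι f ≫ α)) (imageSubobject (kernel.ι g ≫ γ)) = ⊥ ∧
        commutator₃ (imageSubobject (kernel.ι f ≫ α)) (imageSubobject (kernel.ι g ≫ γ))
          (imageSubobject β) = ⊥) := by
  refine ⟨fun X R S r₁ r₂ s₁ s₂ _ _ _ _ => ?_,
    fun A B E D f r g s α β γ hf hg hα hγ => admissible_iff hf hg hα hγ⟩
  have := mono_kernel_ι_comp r₁ r₂
  have := mono_kernel_ι_snd_comp_fst s₁ s₂
  -- Smith-commutation is by definition admissibility of `(r₂, 𝟙 X, s₁)` for the points `r₁` and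
  -- `s₂` split by the diagonals. The second kernel is thus that of `s₂` followed by `s₁`, which
  -- symmetry of `S` identifies with the normalisation.
  have key := admissible_iff (diagonal_fst r₁ r₂) (diagonal_snd s₁ s₂)
    (diagonal_snd r₁ r₂) (diagonal_fst s₁ s₂)
  rw [imageSubobject_mono, imageSubobject_mono, imageSubobject_mono (𝟙 X),
    ← normalisation_eq_mk_kernel_snd s₁ s₂, ← Subobject.top_eq_id] at key
  exact key
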